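/- Let $G$ be a finite group and let $p$ be a prime dividing $|G|$. For a finite group $H$, let the $p$-rank $r_p(H)$ be the maximum $r$ such that $H$ has an elementary abelian $p$-subgroup of order $p^r$. Fix a Sylow $p$-subgroup $P$ of $G$ and let $\Omega=\Omega_1(Z(P))$ be the subgroup generated by the elements of order $p$ in the center $Z(P)$ of $P$. Let $\mathcal{A}_p(G)$ be the poset, ordered by inclusion, of non-trivial elementary abelian $p$-subgroups of $G$, and let $\mathcal{A}_p(G)'$ be the poset of non-empty chains of $\mathcal{A}_p(G)$, ordered by inclusion, on which $G$ acts by conjugation. Let $\mathcal{A}_p(G)'/G$ be the set of orbits, partially ordered by $\overline{c}\le\overline{d}$ if and only if $c_0\subseteq d_0$ for some $c_0\in\overline{c}$, $d_0\in\overline{d}$, and regard it as a finite topological space whose open sets are the downsets. If $r_p(G)-r_p(\Omega)\le 1$, then the finite topological space $\mathcal{A}_p(G)'/G$ is contractible. -/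

import Mathlib

open scoped Pointwise
open PartialOrder

/-- `E` is an elementary abelian `p`-subgroup (the trivial subgroup included): it is commutative
and `x ^ p = 1` for all its elements `x`. -/
def IsElemAbelian {G : Type*} [Group G] (p : ℕ) (E : Subgroup G) : Prop :=
  (∀ x ∈ E, ∀ y ∈ E, x * y = y * x) ∧ ∀ x ∈ E, x ^ p = 1

/-- The `p`-rank of a finite group `G`: the maximum `r` such that `G` has an elementary abelian
`p`-subgroup of order `p ^ r`. -/
noncomputable def pRank (p : ℕ) (G : Type*) [Group G] : ℕ :=
  sSup {r : ℕ | ∃ E : Subgroup G, IsElemAbelian p E ∧ Nat.card E = p ^ r}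

/-- `Ω₁(H)`: the subgroup generated by the elements of order `p` of `H`. -/
def omegaOne {G : Type*} [Group G] (p : ℕ) (H : Subgroup G) : Subgroup G :=
  Subgroup.closure {x : G | x ∈ H ∧ orderOf x = p}

/-- The centre `Z(H)` of a subgroup `H` of `G`, as a subgroup of `G`. -/
def centerOf {G : Type*} [Group G] (H : Subgroup G) : Subgroup G :=
  (Subgroup.center H).map H.subtype

/-- The poset `𝒜_p(G)` of non-trivial elementary abelian `p`-subgroups of `G`,
ordered by inclusion. -/
abbrev ElemAbelianPoset (p : ℕ) (G : Type*) [Group G] : Type _ :=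
  {E : Subgroup G // E ≠ ⊥ ∧ IsElemAbelian p E}

theorem IsElemAbelian.conj {G : Type*} [Group G] {p : ℕ} {E : Subgroup G}
    (hE : IsElemAbelian p E) (g : G) : IsElemAbelian p (MulAut.conj g • E) := by
  constructor
  · intro x hx y hy
    obtain ⟨a, ha, rfl⟩ := (Subgroup.mem_smul_pointwise_iff_exists _ _ _).1 hx
    obtain ⟨b, hb, rfl⟩ := (Subgroup.mem_smul_pointwise_iff_exists _ _ _).1 hy
    rw [← smul_mul', ← smul_mul', hE.1 a ha b hb]
  · intro x hx
    obtain ⟨a, ha, rfl⟩ := (Subgroup.mem_smul_pointwise_iff_exists _ _ _).1 hx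
    rw [← smul_pow', hE.2 a ha, smul_one]

/-- `G` acts on `𝒜_p(G)` by conjugation, `g • E = g E g⁻¹`. -/
instance ElemAbelianPoset.instMulAction (p : ℕ) (G : Type*) [Group G] :
    MulAction G (ElemAbelianPoset p G) where
  smul g E := ⟨MulAut.conj g • E.1, by
    refine ⟨fun h => E.2.1 ?_, E.2.2.conj g⟩
    have h2 := congrArg (fun K => (MulAut.conj g)⁻¹ • K) h
    simpa only [inv_smul_smul, Subgroup.smul_bot] using h2⟩
  one_smul E := Subtype.ext (by
    change MulAut.conj (1 : G) • E.1 = E.1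
    rw [map_one, one_smul])
  mul_smul g h E := Subtype.ext (by
    change MulAut.conj (g * h) • E.1 = MulAut.conj g • MulAut.conj h • E.1
    rw [map_mul, mul_smul])

instance ElemAbelianPoset.instCovariantClass (p : ℕ) (G : Type*) [Group G] :
    CovariantClass G (ElemAbelianPoset p G) HSMul.hSMul LE.le :=
  ⟨fun g A B (h : A.1 ≤ B.1) =>
    show MulAut.conj g • A.1 ≤ MulAut.conj g • B.1 from Subgroup.map_mono h⟩

/-- Translation by `g`, as a monotone map. -/
def smulOrderHom {G X : Type*} [Group G] [PartialOrder X] [MulAction G X]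
    [CovariantClass G X HSMul.hSMul LE.le] (g : G) : X →o X where
  toFun x := g • x
  monotone' _ _ h := CovariantClass.elim g h

/-- If `G` acts on a poset `X` by monotone maps, then it acts on the subdivision `X'`, the poset of
non-empty finite chains of `X` ordered by inclusion: `g • {x₀ < ⋯ < xₙ} = {g • x₀ < ⋯ < g • xₙ}`. -/
noncomputable instance chainMulAction {G X : Type*} [Group G] [PartialOrder X] [MulAction G X]
    [CovariantClass G X HSMul.hSMul LE.le] : MulAction G (NonemptyFiniteChains X) where
  smul g c := c.map (smulOrderHom g)
  one_smul c := by
    ext x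
    change x ∈ (c.map (smulOrderHom (1 : G))).finset ↔ _
    simp [smulOrderHom]
  mul_smul g h c := by
    ext x
    change x ∈ (c.map (smulOrderHom (g * h))).finset ↔
      x ∈ ((c.map (smulOrderHom h)).map (smulOrderHom g)).finset
    simp [smulOrderHom, mul_smul]
    rfl

instance chainCovariantClass {G X : Type*} [Group G] [PartialOrder X] [MulAction G X]
    [CovariantClass G X HSMul.hSMul LE.le] :
    CovariantClass G (NonemptyFiniteChains X) HSMul.hSMul LE.le :=
  ⟨fun g _ _ h => (NonemptyFiniteChains.orderHomMap (smulOrderHom g)).monotone h⟩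

/-- The set `X/G` of orbits of `G` in `X`. -/
def OrbitPoset (G X : Type*) [Group G] [MulAction G X] : Type _ :=
  MulAction.orbitRel.Quotient G X

/-- The orbit of `x`. -/
def OrbitPoset.mk (G : Type*) {X : Type*} [Group G] [MulAction G X] (x : X) : OrbitPoset G X :=
  (Quotient.mk'' x : MulAction.orbitRel.Quotient G X)

/-- The orbit poset `X/G` of a `G`-poset `X`: `a ≤ b` if and only if some representative `x` of
`a` and some representative `y` of `b` satisfy `x ≤ y`. -/
instance OrbitPoset.instPartialOrder {G X : Type*} [Group G] [Finite G] [PartialOrder X]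
    [MulAction G X] [CovariantClass G X HSMul.hSMul LE.le] : PartialOrder (OrbitPoset G X) where
  le a b := ∃ x y : X, OrbitPoset.mk G x = a ∧ OrbitPoset.mk G y = b ∧ x ≤ y
  le_refl a := by
    induction a using Quotient.inductionOn' with
    | h x => exact ⟨x, x, rfl, rfl, le_rfl⟩
  le_trans a b c := by
    rintro ⟨x, y, rfl, rfl, hxy⟩ ⟨y', z, hy, rfl, hyz⟩
    obtain ⟨g, rfl⟩ := MulAction.orbitRel_apply.1 (Quotient.eq''.1 hy)
    exact ⟨g • x, z, Quotient.eq''.2 (MulAction.orbitRel_apply.2 ⟨g, rfl⟩), rfl,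
      (CovariantClass.elim g hxy).trans hyz⟩
  le_antisymm a b := by
    rintro ⟨x, y, rfl, rfl, hxy⟩ ⟨y', x', hy, hx, hyx⟩
    obtain ⟨g, rfl⟩ := MulAction.orbitRel_apply.1 (Quotient.eq''.1 hy)
    obtain ⟨h, rfl⟩ := MulAction.orbitRel_apply.1 (Quotient.eq''.1 hx)
    have hmono : Monotone (fun z : X => (g⁻¹ * h) • z) := fun _ _ h => CovariantClass.elim _ h
    have hyx' : y ≤ (g⁻¹ * h) • x := by
      have h2 : g⁻¹ • g • y ≤ g⁻¹ • h • x := CovariantClass.elim g⁻¹ hyx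
      rwa [inv_smul_smul, ← mul_smul] at h2
    have hpow : ∀ n : ℕ, (g⁻¹ * h) • x ≤ (g⁻¹ * h) ^ (n + 1) • x := by
      intro n
      induction n with
      | zero => simp
      | succ n ih =>
        refine ih.trans ?_
        have h3 : (g⁻¹ * h) ^ (n + 1) • x ≤ (g⁻¹ * h) ^ (n + 1) • (g⁻¹ * h) • x :=
          CovariantClass.elim _ (hxy.trans hyx')
        rwa [← mul_smul, ← pow_succ] at h3
    obtain ⟨m, hm⟩ := Nat.exists_eq_succ_of_ne_zero (orderOf_pos (g⁻¹ * h)).ne'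
    have h4 := hpow m
    rw [← Nat.succ_eq_add_one, ← hm, pow_orderOf_eq_one, one_smul] at h4
    rw [le_antisymm hxy (hyx'.trans h4)]

/-- The finite space `𝒜_p(G)'/G`: the poset of orbits of non-empty chains of non-trivial elementary
abelian `p`-subgroups of `G`, with the topology whose open sets are the downsets. -/
abbrev ElemAbelianChainOrbitSpace (p : ℕ) (G : Type*) [Group G] [Finite G] : Type _ :=
  Topology.WithLowerSet (OrbitPoset G (NonemptyFiniteChains (ElemAbelianPoset p G)))

/-! ### Elementary abelian subgroups, conjugation and Sylow's theorem in centralizers -/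

section GroupTheory

variable {G : Type*} [Group G] {p : ℕ}

/-! Comparable monotone maps of finite spaces are homotopic, so it suffices to join the identity to
a constant by a fence `id ≤ f₁ ≥ f₂ ≤ f₃ ≥ const` of monotone self-maps of the orbit poset. Write
Ω(R) for Ω₁(Z(R)), of order p^r. If the top of a chain lies in no Ω(R), then f₁ adjoins a subgroup M
of order p^(r+1) above it, and f₂ keeps, besides M, only the members lying in some Ω(R); other
chains are fixed by both. Then f₃ also adjoins an Ω(R), and all of these are conjugate to Ω(P). The
discarding is forced: a proper subgroup of M that lies in no Ω(S) is incomparable with an Ω(R)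
inside M.

M and R are mere choices, but they are unique up to conjugation fixing the members that are kept, so
the maps exist on orbits (`OrbitPoset.exists_orderHom`). For M: since the rank gap is at most one, M
= A Ω(R) whenever M ≤ R and A ≤ M lies in no Ω(S); Sylow's theorem in C_G(A) then gives
`RankGapLEOne.exists_conj_eq`. For R: Ω(R) = C_M(t) for every t in N_R(M) outside C_G(M), so Ω(R) is
determined by any p-subgroup containing N_R(M); Sylow's theorem in N_G(M) ∩ C_G(A) gives
`RankGapLEOne.exists_conj_omegaCenter_eq`. -/

theorem mem_conj_smul {g x : G} {A : Subgroup G} :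
    x ∈ MulAut.conj g • A ↔ g⁻¹ * x * g ∈ A := by
  rw [Subgroup.mem_pointwise_smul_iff_inv_smul_mem, ← map_inv]
  simp [MulAut.smul_def]

theorem conj_smul_eq_self_of_commute {g : G} {A : Subgroup G} (h : ∀ x ∈ A, g * x = x * g) :
    MulAut.conj g • A = A := by
  apply le_antisymm
  · intro x hx
    obtain ⟨a, ha, rfl⟩ := (Subgroup.mem_smul_pointwise_iff_exists _ _ _).1 hx
    simpa [MulAut.smul_def, h a ha] using ha
  · intro x hx
    rw [mem_conj_smul, mul_assoc, ← h x hx, inv_mul_cancel_left]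
    exact hx

theorem mem_centralizer_iff' {g : G} {A : Subgroup G} :
    g ∈ Subgroup.centralizer (A : Set G) ↔ ∀ x ∈ A, g * x = x * g := by
  rw [Subgroup.mem_centralizer_iff]
  exact ⟨fun h x hx => (h x hx).symm, fun h x hx => (h x hx).symm⟩

theorem conj_smul_eq_self_of_le_centralizer {g : G} {A B : Subgroup G}
    (hg : g ∈ Subgroup.centralizer (B : Set G)) (hAB : A ≤ B) : MulAut.conj g • A = A :=
  conj_smul_eq_self_of_commute fun x hx => mem_centralizer_iff'.1 hg x (hAB hx)

theorem mem_centerOf {H : Subgroup G} {x : G} :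
    x ∈ centerOf H ↔ x ∈ H ∧ ∀ y ∈ H, x * y = y * x := by
  simp only [centerOf, Subgroup.mem_map, Subgroup.mem_center_iff, Subgroup.coe_subtype,
    Subtype.exists, exists_and_right, exists_eq_right, Subtype.forall, Subtype.ext_iff,
    Subgroup.coe_mul]
  constructor
  · rintro ⟨hx, h⟩
    exact ⟨hx, fun y hy => (h y hy).symm⟩
  · rintro ⟨hx, h⟩
    exact ⟨hx, fun y hy => (h y hy).symm⟩

theorem mem_omegaOne_centerOf [Fact p.Prime] {H : Subgroup G} {x : G} :
    x ∈ omegaOne p (centerOf H) ↔ x ∈ H ∧ (∀ y ∈ H, x * y = y * x) ∧ x ^ p = 1 := by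
  constructor
  · intro hx
    induction hx using Subgroup.closure_induction with
    | mem x hx =>
      obtain ⟨h1, h2⟩ := hx
      exact ⟨(mem_centerOf.1 h1).1, (mem_centerOf.1 h1).2, h2 ▸ pow_orderOf_eq_one x⟩
    | one => exact ⟨H.one_mem, by simp, one_pow p⟩
    | mul x y _ _ hx hy =>
      refine ⟨H.mul_mem hx.1 hy.1, fun z hz => ?_, ?_⟩
      · rw [mul_assoc, hy.2.1 z hz, ← mul_assoc, hx.2.1 z hz, mul_assoc]
      · rw [(show Commute x y from hx.2.1 y hy.1).mul_pow, hx.2.2, hy.2.2, one_mul]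
    | inv x _ hx =>
      refine ⟨H.inv_mem hx.1, fun z hz => ?_, by rw [inv_pow, hx.2.2, inv_one]⟩
      exact ((show Commute x z from hx.2.1 z hz).inv_left).eq
  · rintro ⟨h1, h2, h3⟩
    by_cases hx : x = 1
    · exact hx ▸ Subgroup.one_mem _
    · exact Subgroup.subset_closure ⟨mem_centerOf.2 ⟨h1, h2⟩, orderOf_eq_prime h3 hx⟩

theorem omegaOne_centerOf_conj [Fact p.Prime] (g : G) (H : Subgroup G) :
    omegaOne p (centerOf (MulAut.conj g • H)) = MulAut.conj g • omegaOne p (centerOf H) := by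
  ext x
  rw [mem_conj_smul, mem_omegaOne_centerOf, mem_omegaOne_centerOf, mem_conj_smul]
  refine and_congr Iff.rfl (and_congr ⟨fun h y hy => ?_, fun h y hy => ?_⟩ ?_)
  · have := h (g * y * g⁻¹) (by rw [mem_conj_smul]; simpa [mul_assoc] using hy)
    have h2 := congrArg (fun z => g⁻¹ * z * g) this
    simpa [mul_assoc] using h2
  · have := h _ (mem_conj_smul.1 hy)
    have h2 := congrArg (fun z => g * z * g⁻¹) this
    simpa [mul_assoc] using h2
  · have := conj_pow (a := g⁻¹) (b := x) (i := p)
    rw [inv_inv] at this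
    rw [this]
    constructor
    · intro h; simp [h]
    · intro h
      have h2 := congrArg (fun z => g * z * g⁻¹) h
      simpa [mul_assoc] using h2

theorem isElemAbelian_omegaOne_centerOf [Fact p.Prime] (H : Subgroup G) :
    IsElemAbelian p (omegaOne p (centerOf H)) := by
  constructor
  · intro x hx y hy
    exact (mem_omegaOne_centerOf.1 hx).2.1 y (mem_omegaOne_centerOf.1 hy).1
  · exact fun x hx => (mem_omegaOne_centerOf.1 hx).2.2

theorem le_centralizer_omegaOne_centerOf [Fact p.Prime] (H : Subgroup G) :
    H ≤ Subgroup.centralizer (omegaOne p (centerOf H) : Set G) := fun h hh =>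
  mem_centralizer_iff'.2 fun _ hx => ((mem_omegaOne_centerOf.1 hx).2.1 h hh).symm

theorem IsElemAbelian.le_centralizer {E : Subgroup G} (hE : IsElemAbelian p E) :
    E ≤ Subgroup.centralizer (E : Set G) := fun x hx =>
  mem_centralizer_iff'.2 fun y hy => hE.1 x hx y hy

theorem IsElemAbelian.mono {E F : Subgroup G} (hF : IsElemAbelian p F) (h : E ≤ F) :
    IsElemAbelian p E :=
  ⟨fun x hx y hy => hF.1 x (h hx) y (h hy), fun x hx => hF.2 x (h hx)⟩

theorem isElemAbelian_bot : IsElemAbelian p (⊥ : Subgroup G) := by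
  constructor
  · intro x hx y hy
    rw [Subgroup.mem_bot.1 hx, Subgroup.mem_bot.1 hy]
  · intro x hx
    rw [Subgroup.mem_bot.1 hx, one_pow]

theorem IsElemAbelian.sup {E F : Subgroup G} (hE : IsElemAbelian p E) (hF : IsElemAbelian p F)
    (h : E ≤ Subgroup.centralizer (F : Set G)) : IsElemAbelian p (E ⊔ F) := by
  have hc : E ⊔ F ≤ Subgroup.centralizer ((E ⊔ F : Subgroup G) : Set G) := by
    have h1 : E ⊔ F ≤ Subgroup.centralizer (E : Set G) :=
      sup_le hE.le_centralizer (Subgroup.le_centralizer_iff.1 h)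
    have h2 : E ⊔ F ≤ Subgroup.centralizer (F : Set G) := sup_le h hF.le_centralizer
    exact sup_le (Subgroup.le_centralizer_iff.1 h1) (Subgroup.le_centralizer_iff.1 h2)
  have hcomm : ∀ x ∈ E ⊔ F, ∀ y ∈ E ⊔ F, x * y = y * x := fun x hx y hy =>
    mem_centralizer_iff'.1 (hc hx) y hy
  refine ⟨hcomm, fun x hx => ?_⟩
  have hcl : E ⊔ F = Subgroup.closure ((E : Set G) ∪ F) := by
    rw [Subgroup.closure_union, Subgroup.closure_eq, Subgroup.closure_eq]
  rw [hcl] at hx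
  induction hx using Subgroup.closure_induction with
  | mem x hx => exact hx.elim (hE.2 x) (hF.2 x)
  | one => exact one_pow p
  | mul x y hx hy ihx ihy =>
    rw [(show Commute x y from hcomm x (hcl ▸ hx) y (hcl ▸ hy)).mul_pow, ihx, ihy, one_mul]
  | inv _ _ ih => rw [inv_pow, ih, inv_one]

theorem IsElemAbelian.isPGroup {E : Subgroup G} (hE : IsElemAbelian p E) : IsPGroup p E :=
  fun x => ⟨1, Subtype.ext (by simpa using hE.2 _ x.2)⟩

theorem IsElemAbelian.exists_card_eq [Finite G] [Fact p.Prime] {E : Subgroup G}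
    (hE : IsElemAbelian p E) : ∃ n, Nat.card E = p ^ n :=
  IsPGroup.iff_card.1 hE.isPGroup

/-- Two `p`-subgroups of `H` lie, up to conjugacy in `H`, in a common `p`-subgroup of `H`. -/
theorem exists_conj_le_common_isPGroup [Finite G] [Fact p.Prime] {H M N : Subgroup G}
    (hM : IsPGroup p M) (hN : IsPGroup p N) (hMH : M ≤ H) (hNH : N ≤ H) :
    ∃ h ∈ H, ∃ T ≤ H, IsPGroup p T ∧ M ≤ T ∧ MulAut.conj h • N ≤ T := by
  -- Sylow's theorem is applied inside `H`, which keeps the conjugating element in `H`.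
  obtain ⟨S, hS⟩ := (hM.of_equiv (Subgroup.subgroupOfEquivOfLe hMH).symm).exists_le_sylow
  obtain ⟨S', hS'⟩ := (hN.of_equiv (Subgroup.subgroupOfEquivOfLe hNH).symm).exists_le_sylow
  obtain ⟨h, hh⟩ := MulAction.exists_smul_eq H S' S
  refine ⟨h, h.2, (S : Subgroup H).map H.subtype, Subgroup.map_subtype_le _,
    S.isPGroup'.map _, fun x hx => ⟨⟨_, hMH hx⟩, hS hx, rfl⟩, fun x hx => ?_⟩
  obtain ⟨a, ha, rfl⟩ := (Subgroup.mem_smul_pointwise_iff_exists _ _ _).1 hx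
  refine ⟨h * ⟨a, hNH ha⟩ * h⁻¹, ?_, by simp [MulAut.smul_def]⟩
  rw [← hh]
  change _ ∈ (h • S' : Sylow p H).toSubgroup
  rw [Sylow.coe_subgroup_smul, mem_conj_smul]
  simpa [mul_assoc] using hS' (show (⟨a, hNH ha⟩ : H) ∈ N.subgroupOf H from ha)

/-- `Ω₁(Z(R))` for a Sylow subgroup `R`. -/
abbrev Sylow.omegaCenter (R : Sylow p G) : Subgroup G := omegaOne p (centerOf (R : Subgroup G))

theorem Sylow.omegaCenter_smul [Fact p.Prime] (g : G) (R : Sylow p G) :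
    (g • R).omegaCenter = MulAut.conj g • R.omegaCenter := by
  rw [Sylow.omegaCenter, Sylow.coe_subgroup_smul, omegaOne_centerOf_conj]

theorem Sylow.le_centralizer_of_le_omegaCenter [Fact p.Prime] {R : Sylow p G} {A : Subgroup G}
    (h : A ≤ R.omegaCenter) : (R : Subgroup G) ≤ Subgroup.centralizer (A : Set G) :=
  (le_centralizer_omegaOne_centerOf _).trans (Subgroup.centralizer_le h)

theorem Sylow.omegaCenter_ne_bot [Finite G] [Fact p.Prime] (hp : p ∣ Nat.card G)
    (R : Sylow p G) : R.omegaCenter ≠ ⊥ := by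
  have hR : (R : Subgroup G) ≠ ⊥ := R.ne_bot_of_dvd_card hp
  have : Nontrivial (R : Subgroup G) := (Subgroup.nontrivial_iff_ne_bot _).2 hR
  have : Nontrivial (Subgroup.center (R : Subgroup G)) := R.isPGroup'.center_nontrivial
  obtain ⟨n, hn, hc⟩ := (R.isPGroup'.to_subgroup (Subgroup.center _)).nontrivial_iff_card.1 this
  obtain ⟨x, hx⟩ := exists_prime_orderOf_dvd_card' (G := Subgroup.center (R : Subgroup G)) p
    (hc ▸ dvd_pow_self p hn.ne')
  have hx' : orderOf ((x : (R : Subgroup G)) : G) = p :=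
    (Subgroup.orderOf_coe _).trans ((Subgroup.orderOf_coe x).trans hx)
  intro h
  have : ((x : (R : Subgroup G)) : G) ∈ R.omegaCenter :=
    Subgroup.subset_closure ⟨⟨x, x.2, rfl⟩, hx'⟩
  rw [h, Subgroup.mem_bot] at this
  rw [this, orderOf_one] at hx'
  exact (Fact.out : p.Prime).one_lt.ne hx'

/-- Since `R` centralizes `A`, it is a Sylow subgroup of C_G(A) as well. -/
theorem Sylow.exists_smul_of_le_omegaCenter [Finite G] [Fact p.Prime] {R : Sylow p G}
    {A M : Subgroup G} (hA : A ≤ R.omegaCenter) (hM : IsPGroup p M)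
    (hMA : M ≤ Subgroup.centralizer (A : Set G)) :
    ∃ g ∈ Subgroup.centralizer (A : Set G), M ≤ (g • R : Sylow p G) := by
  obtain ⟨h, hh, T, hT, hTp, hRT, hMT⟩ := exists_conj_le_common_isPGroup R.isPGroup' hM
    (Sylow.le_centralizer_of_le_omegaCenter hA) hMA
  rw [R.is_maximal' hTp hRT] at hMT
  refine ⟨h⁻¹, inv_mem hh, ?_⟩
  rw [Sylow.coe_subgroup_smul, map_inv, ← Subgroup.pointwise_smul_le_pointwise_smul_iff
    (a := MulAut.conj h), smul_inv_smul]
  exact hMT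

theorem Sylow.exists_smul_eq_of_le_omegaCenter [Finite G] [Fact p.Prime] {R R' : Sylow p G}
    {A : Subgroup G} (hA : A ≤ R.omegaCenter) (hA' : A ≤ R'.omegaCenter) :
    ∃ g ∈ Subgroup.centralizer (A : Set G), g • R = R' := by
  obtain ⟨g, hg, hle⟩ := Sylow.exists_smul_of_le_omegaCenter hA R'.isPGroup'
    (Sylow.le_centralizer_of_le_omegaCenter hA')
  exact ⟨g, hg, Sylow.ext (R'.is_maximal' (g • R).isPGroup' hle)⟩

end GroupTheory

/-! ### Consequences of a rank gap of at most one -/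

section RankGap

variable {G : Type*} [Group G] {p : ℕ}

/-- Needed because `sSup` of an unbounded set of naturals is 0. -/
theorem pRank_set_bddAbove [Finite G] [Fact p.Prime] :
    BddAbove {r : ℕ | ∃ E : Subgroup G, IsElemAbelian p E ∧ Nat.card E = p ^ r} := by
  refine ⟨Nat.card G, ?_⟩
  rintro r ⟨E, -, hE⟩
  calc r ≤ p ^ r := (Nat.lt_pow_self (Fact.out : p.Prime).one_lt).le
    _ = Nat.card E := hE.symm
    _ ≤ Nat.card G := Subgroup.card_le_card_group E

theorem IsElemAbelian.card_le_pow_pRank [Finite G] [Fact p.Prime] {E : Subgroup G}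
    (hE : IsElemAbelian p E) : Nat.card E ≤ p ^ pRank p G := by
  obtain ⟨n, hn⟩ := hE.exists_card_eq
  rw [hn]
  exact Nat.pow_le_pow_right (Fact.out : p.Prime).pos (le_csSup pRank_set_bddAbove ⟨E, hE, hn⟩)

theorem IsElemAbelian.pow_pRank_eq_card [Finite G] [Fact p.Prime] {E : Subgroup G}
    (hE : IsElemAbelian p E) : p ^ pRank p E = Nat.card E := by
  have htop : IsElemAbelian p (⊤ : Subgroup E) :=
    ⟨fun x _ y _ => Subtype.ext (hE.1 x x.2 y y.2),
      fun x _ => Subtype.ext (by simpa using hE.2 _ x.2)⟩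
  apply le_antisymm
  · obtain ⟨F, -, hF⟩ := Nat.sSup_mem (s := {r : ℕ | ∃ F : Subgroup E, IsElemAbelian p F ∧
      Nat.card F = p ^ r}) ⟨0, ⊥, isElemAbelian_bot, by simp⟩ pRank_set_bddAbove
    rw [pRank, ← hF]
    exact Subgroup.card_le_card_group F
  · simpa using htop.card_le_pow_pRank

/-- The `p`-rank of `Ω₁(Z(R))` is `r` for all Sylow subgroups `R` of `G`, and the `p`-rank of `G`
is at most `r + 1`. -/
structure RankGapLEOne (G : Type*) [Group G] (p r : ℕ) : Prop where
  card_omegaCenter (R : Sylow p G) : Nat.card R.omegaCenter = p ^ r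
  card_le (E : Subgroup G) : IsElemAbelian p E → Nat.card E ≤ p ^ (r + 1)

theorem rankGapLEOne [Finite G] [Fact p.Prime] (P : Sylow p G)
    (h : (pRank p G : ℤ) - (pRank p (omegaOne p (centerOf (P : Subgroup G))) : ℤ) ≤ 1) :
    RankGapLEOne G p (pRank p (omegaOne p (centerOf (P : Subgroup G)))) where
  card_omegaCenter R := by
    obtain ⟨g, rfl⟩ := MulAction.exists_smul_eq G P R
    rw [Sylow.omegaCenter_smul, (isElemAbelian_omegaOne_centerOf _).pow_pRank_eq_card]
    exact (Nat.card_congr (Subgroup.equivSMul (MulAut.conj g) P.omegaCenter).toEquiv).symm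
  card_le E hE := hE.card_le_pow_pRank.trans
    (Nat.pow_le_pow_right (Fact.out : p.Prime).pos (by lia))

/-- `A` is contained in `Ω₁(Z(R))` for some Sylow subgroup `R`. -/
def IsSubOmega (p : ℕ) (A : Subgroup G) : Prop := ∃ R : Sylow p G, A ≤ R.omegaCenter

/-- `M` is elementary abelian of order greater than `p ^ r`. -/
def IsBig (p r : ℕ) (M : Subgroup G) : Prop := IsElemAbelian p M ∧ p ^ r < Nat.card M

theorem IsSubOmega.mono {A B : Subgroup G} (hB : IsSubOmega p B) (h : A ≤ B) : IsSubOmega p A :=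
  let ⟨R, hR⟩ := hB
  ⟨R, h.trans hR⟩

theorem IsSubOmega.smul [Fact p.Prime] {A : Subgroup G} (hA : IsSubOmega p A) (g : G) :
    IsSubOmega p (MulAut.conj g • A) := by
  obtain ⟨R, hR⟩ := hA
  refine ⟨g • R, ?_⟩
  rw [Sylow.omegaCenter_smul]
  exact Subgroup.pointwise_smul_le_pointwise_smul_iff.2 hR

theorem isSubOmega_smul_iff [Fact p.Prime] {A : Subgroup G} {g : G} :
    IsSubOmega p (MulAut.conj g • A) ↔ IsSubOmega p A := by
  refine ⟨fun h => ?_, fun h => h.smul g⟩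
  simpa [map_inv] using h.smul g⁻¹

theorem IsBig.smul {r : ℕ} {M : Subgroup G} (hM : IsBig p r M) (g : G) :
    IsBig p r (MulAut.conj g • M) :=
  ⟨hM.1.conj g, (Nat.card_congr (Subgroup.equivSMul (MulAut.conj g) M).toEquiv) ▸ hM.2⟩

theorem RankGapLEOne.isBig_of_omegaCenter_lt [Finite G] {r : ℕ} (h : RankGapLEOne G p r)
    {M : Subgroup G}
    (hM : IsElemAbelian p M) {R : Sylow p G} (hlt : R.omegaCenter < M) : IsBig p r M := by
  refine ⟨hM, ?_⟩
  rw [← h.card_omegaCenter R]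
  by_contra! hcard
  exact hlt.ne (Subgroup.eq_of_le_of_card_ge hlt.le hcard)

variable [Finite G] [Fact p.Prime] {r : ℕ}

/-- No power of p lies strictly between p^r and p^(r+1), so big subgroups have the largest order
possible; their maximality follows. -/
theorem RankGapLEOne.card_eq (h : RankGapLEOne G p r) {M : Subgroup G} (hM : IsBig p r M) :
    Nat.card M = p ^ (r + 1) := by
  obtain ⟨n, hn⟩ := hM.1.exists_card_eq
  have h1 := hM.2
  have h2 := h.card_le M hM.1
  rw [hn] at h1 h2 ⊢
  have h3 := (Nat.pow_lt_pow_iff_right (Fact.out : p.Prime).one_lt).1 h1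
  have h4 := (Nat.pow_le_pow_iff_right (Fact.out : p.Prime).one_lt).1 h2
  rw [le_antisymm h4 h3]

theorem RankGapLEOne.eq_of_le (h : RankGapLEOne G p r) {M E : Subgroup G} (hM : IsBig p r M)
    (hE : IsElemAbelian p E) (hle : M ≤ E) : M = E :=
  Subgroup.eq_of_le_of_card_ge hle ((h.card_le E hE).trans (h.card_eq hM).ge)

/-- The product of `M` and `E` is elementary abelian, so it equals `M` by maximality. -/
theorem RankGapLEOne.le_of_commute (h : RankGapLEOne G p r) {M E : Subgroup G} (hM : IsBig p r M)
    (hE : IsElemAbelian p E) (hc : M ≤ Subgroup.centralizer (E : Set G)) : E ≤ M :=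
  (h.eq_of_le hM (hM.1.sup hE hc) le_sup_left).symm ▸ le_sup_right

theorem RankGapLEOne.omegaCenter_le (h : RankGapLEOne G p r) {M : Subgroup G} (hM : IsBig p r M)
    {R : Sylow p G} (hMR : M ≤ R) : R.omegaCenter ≤ M :=
  h.le_of_commute hM (isElemAbelian_omegaOne_centerOf _)
    (hMR.trans (le_centralizer_omegaOne_centerOf _))

theorem RankGapLEOne.isBig_sup (h : RankGapLEOne G p r) {A : Subgroup G}
    (hA : IsElemAbelian p A) (hA' : ¬ IsSubOmega p A) {R : Sylow p G} (hR : A ≤ R) :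
    IsBig p r (A ⊔ R.omegaCenter) := by
  refine h.isBig_of_omegaCenter_lt (R := R) (hA.sup (isElemAbelian_omegaOne_centerOf _)
    (hR.trans (le_centralizer_omegaOne_centerOf _))) (lt_of_le_of_ne le_sup_right fun heq => ?_)
  exact hA' ⟨R, heq ▸ le_sup_left⟩

theorem RankGapLEOne.exists_isBig (h : RankGapLEOne G p r) {A : Subgroup G}
    (hA : IsElemAbelian p A) (hA' : ¬ IsSubOmega p A) : ∃ M, IsBig p r M ∧ A ≤ M := by
  obtain ⟨R, hR⟩ := hA.isPGroup.exists_le_sylow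
  exact ⟨_, h.isBig_sup hA hA' hR, le_sup_left⟩

theorem RankGapLEOne.eq_sup_omegaCenter (h : RankGapLEOne G p r) {A S M : Subgroup G}
    {R : Sylow p G} (hA : ¬ IsSubOmega p A) (hM : IsBig p r M) (hAM : A ≤ M) (hMS : M ≤ S)
    (hSR : S ≤ R) : M = A ⊔ R.omegaCenter := by
  have hAR := hAM.trans (hMS.trans hSR)
  exact (h.eq_of_le (h.isBig_sup (hM.1.mono hAM) hA hAR) hM.1
    (sup_le hAM (h.omegaCenter_le hM (hMS.trans hSR)))).symm

/-- Big subgroups containing a subgroup `A` that is in no `Ω₁(Z(R))` are conjugate in `C_G(A)`. -/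
theorem RankGapLEOne.exists_conj_eq (h : RankGapLEOne G p r) {A M N : Subgroup G}
    (hA : ¬ IsSubOmega p A) (hM : IsBig p r M) (hN : IsBig p r N) (hAM : A ≤ M) (hAN : A ≤ N) :
    ∃ g ∈ Subgroup.centralizer (A : Set G), MulAut.conj g • M = N := by
  obtain ⟨g, hg, T, hT, hTp, hNT, hMT⟩ := exists_conj_le_common_isPGroup hN.1.isPGroup
    hM.1.isPGroup (hN.1.le_centralizer.trans (Subgroup.centralizer_le hAN))
    (hM.1.le_centralizer.trans (Subgroup.centralizer_le hAM))
  obtain ⟨R, hR⟩ := hTp.exists_le_sylow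
  refine ⟨g, hg, ?_⟩
  -- As `g` centralizes `A`, both `N` and the conjugate of `M` contain `A` and lie in `R`, so each
  -- is the join of `A` and Ω₁(Z(R)).
  rw [h.eq_sup_omegaCenter hA hN hAN hNT hR]
  refine h.eq_sup_omegaCenter hA (hM.smul g) ?_ hMT hR
  rw [← conj_smul_eq_self_of_le_centralizer hg le_rfl]
  exact Subgroup.pointwise_smul_le_pointwise_smul_iff.2 hAM

/-- Ω₁(Z(R)) has index p in `M`, so nothing lies strictly between them. -/
theorem RankGapLEOne.eq_omegaCenter (h : RankGapLEOne G p r) {M K : Subgroup G} {R : Sylow p G}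
    (hM : IsBig p r M) (hRK : R.omegaCenter ≤ K) (hKM : K < M) : K = R.omegaCenter := by
  by_contra hne
  have hK := hM.1.mono hKM.le
  exact hKM.ne (h.eq_of_le (h.isBig_of_omegaCenter_lt hK (lt_of_le_of_ne hRK (Ne.symm hne)))
    hM.1 hKM.le)

/-- Some element of `N_R(M)` does not centralize `M`. -/
theorem RankGapLEOne.exists_mem_normalizer (h : RankGapLEOne G p r) {M : Subgroup G}
    {R : Sylow p G} (hM : IsBig p r M) (hM' : ¬ IsSubOmega p M) (hMR : M ≤ R) :
    ∃ t ∈ R, MulAut.conj t • M = M ∧ t ∉ Subgroup.centralizer (M : Set G) := by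
  let D : Subgroup (R : Subgroup G) :=
    (Subgroup.centralizer (M : Set G)).subgroupOf (R : Subgroup G)
  -- `D` is C_R(M); if it were all of `R`, then `M` would be central in `R`, hence inside Ω₁(Z(R)).
  have hD : D < ⊤ := by
    refine lt_of_le_of_ne le_top fun hD => hM' ⟨R, fun x hx => ?_⟩
    refine mem_omegaOne_centerOf.2 ⟨hMR hx, fun y hy => ?_, hM.1.2 x hx⟩
    have : (⟨y, hy⟩ : (R : Subgroup G)) ∈ D := hD ▸ Subgroup.mem_top _
    exact (mem_centralizer_iff'.1 (Subgroup.mem_subgroupOf.1 this) x hx).symm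
  -- Normalizers grow in the nilpotent group `R`, so some `t` outside `D` normalizes `D`. It moves
  -- `M ≤ D` into `D`, and a conjugate of `M` that centralizes `M` lies in `M`.
  have : Group.IsNilpotent (R : Subgroup G) := R.isPGroup'.isNilpotent
  obtain ⟨t, ht, htD⟩ := SetLike.exists_of_lt (Group.normalizerCondition_of_isNilpotent D hD)
  refine ⟨t, t.2, ?_, fun hc => htD (Subgroup.mem_subgroupOf.2 hc)⟩
  have hle : MulAut.conj (t : G) • M ≤ M := by
    refine h.le_of_commute hM (hM.1.conj _) ?_
    rw [Subgroup.le_centralizer_iff]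
    intro x hx
    obtain ⟨a, ha, rfl⟩ := (Subgroup.mem_smul_pointwise_iff_exists _ _ _).1 hx
    have haD : (⟨a, hMR ha⟩ : (R : Subgroup G)) ∈ D :=
      Subgroup.mem_subgroupOf.2 (hM.1.le_centralizer ha)
    exact Subgroup.mem_subgroupOf.1 ((Subgroup.mem_normalizer_iff.1 ht _).1 haD)
  exact Subgroup.eq_of_le_of_card_ge hle
    (Nat.card_congr (Subgroup.equivSMul (MulAut.conj (t : G)) M).toEquiv).le

/-- `Ω₁(Z(R))` is the centralizer in `M` of any `p`-group normalizing `M` that contains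
`N_R(M)`. -/
theorem RankGapLEOne.omegaCenter_eq_inf (h : RankGapLEOne G p r) {M T : Subgroup G}
    {R : Sylow p G} (hM : IsBig p r M) (hM' : ¬ IsSubOmega p M) (hMR : M ≤ R)
    (hT : IsPGroup p T) (hRT : ∀ t ∈ R, MulAut.conj t • M = M → t ∈ T) :
    R.omegaCenter = M ⊓ Subgroup.centralizer (T : Set G) := by
  obtain ⟨t, htR, htM, htc⟩ := h.exists_mem_normalizer hM hM' hMR
  obtain ⟨Q, hQ⟩ := hT.exists_le_sylow
  have hMT : M ≤ T := fun x hx => hRT x (hMR hx)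
    (conj_smul_eq_self_of_le_centralizer (hM.1.le_centralizer hx) le_rfl)
  have hQM := h.omegaCenter_le hM (hMT.trans hQ)
  -- C_M(t) is proper in `M` and contains Ω₁(Z(S)), so they agree. The same `t` serves both `R` and
  -- the Sylow subgroup `Q` above `T`.
  have key : ∀ (S : Sylow p G), t ∈ S → S.omegaCenter ≤ M →
      M ⊓ Subgroup.centralizer {t} = S.omegaCenter := by
    intro S htS hSM
    refine h.eq_omegaCenter hM (le_inf hSM fun x hx => ?_) (lt_of_le_of_ne inf_le_left fun he => ?_)
    · rw [Subgroup.mem_centralizer_singleton_iff]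
      exact (mem_omegaOne_centerOf.1 hx).2.1 t htS
    · refine htc (mem_centralizer_iff'.2 fun x hx => ?_)
      exact (Subgroup.mem_centralizer_singleton_iff.1 (inf_eq_left.1 he hx)).symm
  have hR := key R htR (h.omegaCenter_le hM hMR)
  have hQ' := key Q (hQ (hRT t htR htM)) hQM
  apply le_antisymm
  · rw [← hR, hQ']
    exact le_inf hQM (Subgroup.le_centralizer_iff.1
      (hQ.trans (le_centralizer_omegaOne_centerOf _)))
  · rw [← hR]
    exact inf_le_inf_left _ (Subgroup.centralizer_le (by simpa using hRT t htR htM))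

/-- The subgroups `Ω₁(Z(R))` with `A ≤ Ω₁(Z(R))` and `M ≤ R` are conjugate in
`N_G(M) ∩ C_G(A)`. -/
theorem RankGapLEOne.exists_conj_omegaCenter_eq (h : RankGapLEOne G p r) {A M : Subgroup G}
    {R S : Sylow p G} (hM : IsBig p r M) (hM' : ¬ IsSubOmega p M) (hMR : M ≤ R) (hMS : M ≤ S)
    (hAR : A ≤ R.omegaCenter) (hAS : A ≤ S.omegaCenter) :
    ∃ g ∈ Subgroup.centralizer (A : Set G), MulAut.conj g • M = M ∧
      MulAut.conj g • R.omegaCenter = S.omegaCenter := by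
  let N : Subgroup G := (MulAction.stabilizer (MulAut G) M).comap MulAut.conj
  have hN : ∀ t, t ∈ N ↔ MulAut.conj t • M = M := fun t => Iff.rfl
  -- `T` contains N_S(M) and the `g`-conjugate of N_R(M), so both centers in question equal C_M(T).
  obtain ⟨g, hg, T, -, hTp, hST, hRT⟩ := exists_conj_le_common_isPGroup
    (H := N ⊓ Subgroup.centralizer (A : Set G)) (M := S ⊓ N) (N := R ⊓ N)
    (S.isPGroup'.to_le inf_le_left) (R.isPGroup'.to_le inf_le_left)
    (le_inf inf_le_right (inf_le_left.trans (Sylow.le_centralizer_of_le_omegaCenter hAS)))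
    (le_inf inf_le_right (inf_le_left.trans (Sylow.le_centralizer_of_le_omegaCenter hAR)))
  have hgM := (hN g).1 hg.1
  refine ⟨g, hg.2, hgM, ?_⟩
  rw [← Sylow.omegaCenter_smul, h.omegaCenter_eq_inf hM hM' hMS hTp fun t ht ht' =>
    hST ⟨ht, ht'⟩]
  refine h.omegaCenter_eq_inf hM hM' ?_ hTp fun t ht ht' => hRT ?_
  · rw [Sylow.coe_subgroup_smul, ← hgM]
    exact Subgroup.pointwise_smul_le_pointwise_smul_iff.2 hMR
  · rw [Sylow.smul_def] at ht
    rw [mem_conj_smul]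
    refine ⟨mem_conj_smul.1 ht, ?_⟩
    exact N.mul_mem (N.mul_mem (N.inv_mem hg.1) ht') hg.1

end RankGap

/-! ### Homotopies of finite spaces and monotone maps of orbit posets -/

section FiniteSpaces

/-- Comparable monotone maps between lower set spaces are homotopic. -/
theorem Topology.WithLowerSet.homotopic_of_le {X Y : Type*} [PartialOrder X] [PartialOrder Y]
    {f g : X →o Y} (h : f ≤ g) :
    (Topology.WithLowerSet.map f).Homotopic (Topology.WithLowerSet.map g) := by
  classical
  -- The homotopy is `f` on [0, 1) and jumps to `g` at time 1; continuity holds because preimages of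
  -- a downset under `g` lie in those under `f`.
  refine ⟨⟨⟨fun q => if q.1 < 1 then Topology.WithLowerSet.map f q.2
    else Topology.WithLowerSet.map g q.2, ?_⟩, fun x => if_pos zero_lt_one,
    fun x => if_neg (lt_irrefl _)⟩⟩
  refine continuous_def.2 fun U hU => ?_
  have hU' : IsLowerSet U := Topology.IsLowerSet.isOpen_iff_isLowerSet.1 hU
  have : (fun q : unitInterval × Topology.WithLowerSet X =>
      if q.1 < 1 then Topology.WithLowerSet.map f q.2
        else Topology.WithLowerSet.map g q.2) ⁻¹' U =
      (Set.Iio 1 ×ˢ (Topology.WithLowerSet.map f ⁻¹' U)) ∪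
        (Set.univ ×ˢ (Topology.WithLowerSet.map g ⁻¹' U)) := by
    ext ⟨t, x⟩
    have hx : Topology.WithLowerSet.map g x ∈ U → Topology.WithLowerSet.map f x ∈ U :=
      hU' (h (Topology.WithLowerSet.ofLowerSet x))
    by_cases ht : t < 1
    · simpa [ht] using hx
    · simp [ht]
  rw [this]
  exact (isOpen_Iio.prod (hU.preimage (map_continuous _))).union
    (isOpen_univ.prod (hU.preimage (map_continuous _)))

theorem OrbitPoset.mk_eq_mk_iff {G X : Type*} [Group G] [MulAction G X] {x y : X} :
    OrbitPoset.mk G x = OrbitPoset.mk G y ↔ ∃ g : G, g • y = x :=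
  Quotient.eq''.trans MulAction.orbitRel_apply

theorem OrbitPoset.mk_smul {G X : Type*} [Group G] [MulAction G X] (g : G) (x : X) :
    OrbitPoset.mk G (g • x) = OrbitPoset.mk G x :=
  OrbitPoset.mk_eq_mk_iff.2 ⟨g, rfl⟩

section

variable {G X : Type*} [Group G] [Finite G] [PartialOrder X] [MulAction G X]
  [CovariantClass G X HSMul.hSMul LE.le]

theorem OrbitPoset.mk_le_mk_iff {x y : X} :
    OrbitPoset.mk G x ≤ OrbitPoset.mk G y ↔ ∃ g : G, g • x ≤ y := by
  constructor
  · rintro ⟨x', y', hx, hy, h⟩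
    obtain ⟨g, rfl⟩ := OrbitPoset.mk_eq_mk_iff.1 hx
    obtain ⟨k, rfl⟩ := OrbitPoset.mk_eq_mk_iff.1 hy
    refine ⟨k⁻¹ * g, ?_⟩
    have h2 : k⁻¹ • g • x ≤ k⁻¹ • k • y := CovariantClass.elim k⁻¹ h
    rwa [inv_smul_smul, ← mul_smul] at h2
  · rintro ⟨g, h⟩
    exact ⟨g • x, y, OrbitPoset.mk_smul g x, rfl, h⟩

/-- An equivariant relation that is total and monotone up to translation induces a monotone map
of orbit posets. -/
theorem OrbitPoset.exists_orderHom (T : X → X → Prop) (total : ∀ x, ∃ y, T x y)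
    (smul : ∀ (g : G) x y, T x y → T (g • x) (g • y))
    (mono : ∀ x x' y y', x ≤ x' → T x y → T x' y' → ∃ g : G, g • y ≤ y') :
    ∃ f : OrbitPoset G X →o OrbitPoset G X,
      ∀ x y, T x y → f (OrbitPoset.mk G x) = OrbitPoset.mk G y := by
  -- Applied both ways to one orbit, this also gives independence of all choices, by antisymmetry.
  have key : ∀ x x' y y', OrbitPoset.mk G x ≤ OrbitPoset.mk G x' → T x y → T x' y' →
      OrbitPoset.mk G y ≤ OrbitPoset.mk G y' := by
    intro x x' y y' h hy hy'
    obtain ⟨g, hg⟩ := OrbitPoset.mk_le_mk_iff.1 h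
    rw [← OrbitPoset.mk_smul g y]
    exact OrbitPoset.mk_le_mk_iff.2 (mono _ _ _ _ hg (smul g _ _ hy) hy')
  choose F hF using total
  have hmk : ∀ a : OrbitPoset G X, OrbitPoset.mk G (Quotient.out a) = a := fun a =>
    Quotient.out_eq a
  refine ⟨⟨fun a => OrbitPoset.mk G (F (Quotient.out a)), fun a b hab => ?_⟩, fun x y hxy => ?_⟩
  · exact key _ _ _ _ (by rwa [hmk, hmk]) (hF _) (hF _)
  · exact le_antisymm (key _ _ _ _ (hmk _).le (hF _) hxy) (key _ _ _ _ (hmk _).ge hxy (hF _))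

end

/-! ### Finite chains and their translates -/

namespace PartialOrder.NonemptyFiniteChains

variable {X : Type*} [PartialOrder X]

theorem exists_forall_le (c : NonemptyFiniteChains X) :
    ∃ A ∈ c.finset, ∀ B ∈ c.finset, B ≤ A := by
  obtain ⟨A, hA⟩ := c.finset.exists_maximal c.nonempty
  refine ⟨A, hA.1, fun B hB => ?_⟩
  obtain h | h := c.comparable ⟨A, hA.1⟩ ⟨B, hB⟩
  · exact hA.2 hB h
  · exact h

theorem isChain (c : NonemptyFiniteChains X) : IsChain (· ≤ ·) (c.finset : Set X) :=
  fun a ha b hb _ => c.comparable ⟨a, ha⟩ ⟨b, hb⟩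

theorem exists_mem_iff [Finite X] {s : Set X} (hs : IsChain (· ≤ ·) s) (hne : s.Nonempty) :
    ∃ c : NonemptyFiniteChains X, ∀ x, x ∈ c.finset ↔ x ∈ s := by
  refine ⟨⟨s.toFinite.toFinset, by simpa using hne, ?_⟩, fun x => by simp⟩
  rintro ⟨a, ha⟩ ⟨b, hb⟩
  exact hs.total (by simpa using ha) (by simpa using hb)

variable {G : Type*} [Group G] [MulAction G X] [CovariantClass G X HSMul.hSMul LE.le]

theorem mem_smul_iff {g : G} {c : NonemptyFiniteChains X} {x : X} :
    x ∈ (g • c).finset ↔ g⁻¹ • x ∈ c.finset := by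
  change x ∈ (c.map (smulOrderHom g)).finset ↔ _
  rw [mem_map_iff]
  constructor
  · rintro ⟨y, hy, rfl⟩
    change g⁻¹ • g • y ∈ c.finset
    rwa [inv_smul_smul]
  · exact fun h => ⟨_, h, smul_inv_smul g x⟩

theorem smul_le_iff {g : G} {c d : NonemptyFiniteChains X} :
    g • c ≤ d ↔ ∀ x ∈ c.finset, g • x ∈ d.finset := by
  constructor
  · exact fun h x hx => h (mem_smul_iff.2 (by rwa [inv_smul_smul]))
  · intro h x hx
    simpa using h _ (mem_smul_iff.1 hx)

theorem forall_mem_smul_iff {g : G} {c : NonemptyFiniteChains X} {Q : X → Prop} :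
    (∀ x ∈ (g • c).finset, Q x) ↔ ∀ x ∈ c.finset, Q (g • x) := by
  constructor
  · exact fun h x hx => h _ (mem_smul_iff.2 (by rwa [inv_smul_smul]))
  · intro h x hx
    simpa using h _ (mem_smul_iff.1 hx)

end PartialOrder.NonemptyFiniteChains

end FiniteSpaces

/-! ### The three modifications of chains -/

section ChainMaps

variable {G : Type*} [Group G] {p r : ℕ}

theorem ElemAbelianPoset.coe_smul (g : G) (A : ElemAbelianPoset p G) :
    (g • A).1 = MulAut.conj g • A.1 := rfl

theorem ElemAbelianPoset.smul_eq_self {g : G} {A : ElemAbelianPoset p G} {B : Subgroup G}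
    (hg : g ∈ Subgroup.centralizer (B : Set G)) (hAB : A.1 ≤ B) : g • A = A :=
  Subtype.ext (conj_smul_eq_self_of_le_centralizer hg hAB)

theorem conj_inv_smul_eq_iff {g : G} {A B : Subgroup G} :
    MulAut.conj g⁻¹ • A = B ↔ A = MulAut.conj g • B := by
  rw [map_inv, inv_smul_eq_iff]

/-- `e` arises from `c` by adjoining a big subgroup at the top, unless all members of `c` are
contained in some `Ω₁(Z(R))`. -/
def AdjoinBig (p r : ℕ) (c e : NonemptyFiniteChains (ElemAbelianPoset p G)) : Prop :=
  (∀ A ∈ c.finset, IsSubOmega p A.1) ∧ e = c ∨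
    (∃ A ∈ c.finset, ¬ IsSubOmega p A.1) ∧ ∃ M : Subgroup G, IsBig p r M ∧
      (∀ A ∈ c.finset, A.1 ≤ M) ∧ ∀ X, X ∈ e.finset ↔ X.1 = M ∨ X ∈ c.finset

/-- As `AdjoinBig`, but members of `c` that are in no `Ω₁(Z(R))` are dropped. -/
def ReplaceBig (p r : ℕ) (c e : NonemptyFiniteChains (ElemAbelianPoset p G)) : Prop :=
  (∀ A ∈ c.finset, IsSubOmega p A.1) ∧ e = c ∨
    (∃ A ∈ c.finset, ¬ IsSubOmega p A.1) ∧ ∃ M : Subgroup G, IsBig p r M ∧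
      (∀ A ∈ c.finset, A.1 ≤ M) ∧
      ∀ X, X ∈ e.finset ↔ X.1 = M ∨ X ∈ c.finset ∧ IsSubOmega p X.1

/-- As `ReplaceBig`, but additionally some `Ω₁(Z(R))` is adjoined to `c`. -/
def AdjoinOmega (p r : ℕ) (c e : NonemptyFiniteChains (ElemAbelianPoset p G)) : Prop :=
  (∀ A ∈ c.finset, IsSubOmega p A.1) ∧ (∃ R : Sylow p G,
      (∀ A ∈ c.finset, A.1 ≤ R.omegaCenter) ∧
      ∀ X, X ∈ e.finset ↔ X.1 = R.omegaCenter ∨ X ∈ c.finset) ∨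
    (∃ A ∈ c.finset, ¬ IsSubOmega p A.1) ∧ ∃ (M : Subgroup G) (R : Sylow p G), IsBig p r M ∧
      (∀ A ∈ c.finset, A.1 ≤ M) ∧ M ≤ R ∧
      (∀ A ∈ c.finset, IsSubOmega p A.1 → A.1 ≤ R.omegaCenter) ∧
      ∀ X, X ∈ e.finset ↔ X.1 = M ∨ X.1 = R.omegaCenter ∨ X ∈ c.finset ∧ IsSubOmega p X.1

theorem forall_le_smul {c : NonemptyFiniteChains (ElemAbelianPoset p G)} (g : G)
    {M : Subgroup G} (h : ∀ A ∈ c.finset, A.1 ≤ M) :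
    ∀ A ∈ (g • c).finset, A.1 ≤ MulAut.conj g • M :=
  NonemptyFiniteChains.forall_mem_smul_iff.2 fun A hA =>
    Subgroup.pointwise_smul_le_pointwise_smul_iff.2 (h A hA)

/-- `IsSubOmega` passes to subgroups, so its failure passes up to the top member, whose centralizer
fixes the whole chain. -/
theorem exists_max_not_isSubOmega {c : NonemptyFiniteChains (ElemAbelianPoset p G)}
    (h : ∃ A ∈ c.finset, ¬ IsSubOmega p A.1) :
    ∃ A ∈ c.finset, ¬ IsSubOmega p A.1 ∧ ∀ B ∈ c.finset, B.1 ≤ A.1 := by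
  obtain ⟨A, hA, hmax⟩ := c.exists_forall_le
  obtain ⟨B, hB, hB'⟩ := h
  exact ⟨A, hA, fun hs => hB' (hs.mono (hmax B hB)), hmax⟩

section Smul

variable [Fact p.Prime] {c e : NonemptyFiniteChains (ElemAbelianPoset p G)}

theorem forall_isSubOmega_smul (g : G) (h : ∀ A ∈ c.finset, IsSubOmega p A.1) :
    ∀ A ∈ (g • c).finset, IsSubOmega p A.1 :=
  NonemptyFiniteChains.forall_mem_smul_iff.2 fun A hA => (h A hA).smul g

theorem exists_not_isSubOmega_smul (g : G) (h : ∃ A ∈ c.finset, ¬ IsSubOmega p A.1) :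
    ∃ A ∈ (g • c).finset, ¬ IsSubOmega p A.1 := by
  obtain ⟨A, hA, hA'⟩ := h
  exact ⟨g • A, NonemptyFiniteChains.mem_smul_iff.2 (by rwa [inv_smul_smul]),
    fun hs => hA' (isSubOmega_smul_iff.1 hs)⟩

theorem AdjoinBig.smul (g : G) (h : AdjoinBig p r c e) : AdjoinBig p r (g • c) (g • e) := by
  obtain ⟨h1, rfl⟩ | ⟨h1, M, hM, hcM, he⟩ := h
  · exact Or.inl ⟨forall_isSubOmega_smul g h1, rfl⟩
  · refine Or.inr ⟨exists_not_isSubOmega_smul g h1, _, hM.smul g, forall_le_smul g hcM,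
      fun X => ?_⟩
    rw [NonemptyFiniteChains.mem_smul_iff, he, NonemptyFiniteChains.mem_smul_iff,
      ElemAbelianPoset.coe_smul, conj_inv_smul_eq_iff]

theorem ReplaceBig.smul (g : G) (h : ReplaceBig p r c e) : ReplaceBig p r (g • c) (g • e) := by
  obtain ⟨h1, rfl⟩ | ⟨h1, M, hM, hcM, he⟩ := h
  · exact Or.inl ⟨forall_isSubOmega_smul g h1, rfl⟩
  · refine Or.inr ⟨exists_not_isSubOmega_smul g h1, _, hM.smul g, forall_le_smul g hcM,
      fun X => ?_⟩
    rw [NonemptyFiniteChains.mem_smul_iff, he, NonemptyFiniteChains.mem_smul_iff,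
      ElemAbelianPoset.coe_smul, conj_inv_smul_eq_iff, isSubOmega_smul_iff]

theorem AdjoinOmega.smul (g : G) (h : AdjoinOmega p r c e) :
    AdjoinOmega p r (g • c) (g • e) := by
  obtain ⟨h1, R, hcR, he⟩ | ⟨h1, M, R, hM, hcM, hMR, hcR, he⟩ := h
  · refine Or.inl ⟨forall_isSubOmega_smul g h1, g • R, ?_, fun X => ?_⟩
    · rw [Sylow.omegaCenter_smul]
      exact forall_le_smul g hcR
    · rw [NonemptyFiniteChains.mem_smul_iff, he, NonemptyFiniteChains.mem_smul_iff,
        ElemAbelianPoset.coe_smul, conj_inv_smul_eq_iff, Sylow.omegaCenter_smul]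
  · refine Or.inr ⟨exists_not_isSubOmega_smul g h1, _, g • R, hM.smul g, forall_le_smul g hcM,
      ?_, ?_, fun X => ?_⟩
    · rw [Sylow.coe_subgroup_smul]
      exact Subgroup.pointwise_smul_le_pointwise_smul_iff.2 hMR
    · rw [Sylow.omegaCenter_smul]
      exact NonemptyFiniteChains.forall_mem_smul_iff.2 fun A hA hA' =>
        Subgroup.pointwise_smul_le_pointwise_smul_iff.2 (hcR A hA (isSubOmega_smul_iff.1 hA'))
    · rw [NonemptyFiniteChains.mem_smul_iff, he, NonemptyFiniteChains.mem_smul_iff,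
        ElemAbelianPoset.coe_smul, conj_inv_smul_eq_iff, conj_inv_smul_eq_iff,
        Sylow.omegaCenter_smul, isSubOmega_smul_iff]

end Smul

variable [Finite G] [Fact p.Prime] {c d e e' : NonemptyFiniteChains (ElemAbelianPoset p G)}

theorem AdjoinBig.mono (h : RankGapLEOne G p r) (hcd : c ≤ d) (hc : AdjoinBig p r c e)
    (hd : AdjoinBig p r d e') : ∃ g : G, g • e ≤ e' := by
  obtain ⟨hc1, rfl⟩ | ⟨hc1, M, hM, hcM, he⟩ := hc
  · refine ⟨1, ?_⟩
    rw [one_smul]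
    obtain ⟨hd1, rfl⟩ | ⟨hd1, N, hN, hdN, he'⟩ := hd
    · exact hcd
    · exact fun X hX => (he' X).2 (Or.inr (hcd hX))
  · obtain ⟨A, hA, hA', hmax⟩ := exists_max_not_isSubOmega hc1
    obtain ⟨hd1, rfl⟩ | ⟨hd1, N, hN, hdN, he'⟩ := hd
    · exact absurd (hd1 A (hcd hA)) hA'
    · obtain ⟨g, hg, rfl⟩ := h.exists_conj_eq hA' hM hN (hcM A hA) (hdN A (hcd hA))
      refine ⟨g, NonemptyFiniteChains.smul_le_iff.2 fun X hX => (he' _).2 ?_⟩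
      obtain hX | hX := (he X).1 hX
      · exact Or.inl (by rw [ElemAbelianPoset.coe_smul, hX])
      · rw [ElemAbelianPoset.smul_eq_self hg (hmax X hX)]
        exact Or.inr (hcd hX)

theorem ReplaceBig.mono (h : RankGapLEOne G p r) (hcd : c ≤ d) (hc : ReplaceBig p r c e)
    (hd : ReplaceBig p r d e') : ∃ g : G, g • e ≤ e' := by
  obtain ⟨hc1, rfl⟩ | ⟨hc1, M, hM, hcM, he⟩ := hc
  · refine ⟨1, ?_⟩
    rw [one_smul]
    obtain ⟨hd1, rfl⟩ | ⟨hd1, N, hN, hdN, he'⟩ := hd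
    · exact hcd
    · exact fun X hX => (he' X).2 (Or.inr ⟨hcd hX, hc1 X hX⟩)
  · obtain ⟨A, hA, hA', hmax⟩ := exists_max_not_isSubOmega hc1
    obtain ⟨hd1, rfl⟩ | ⟨hd1, N, hN, hdN, he'⟩ := hd
    · exact absurd (hd1 A (hcd hA)) hA'
    · obtain ⟨g, hg, rfl⟩ := h.exists_conj_eq hA' hM hN (hcM A hA) (hdN A (hcd hA))
      refine ⟨g, NonemptyFiniteChains.smul_le_iff.2 fun X hX => (he' _).2 ?_⟩
      obtain hX | ⟨hX, hX'⟩ := (he X).1 hX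
      · exact Or.inl (by rw [ElemAbelianPoset.coe_smul, hX])
      · rw [ElemAbelianPoset.smul_eq_self hg (hmax X hX)]
        exact Or.inr ⟨hcd hX, hX'⟩

theorem exists_smul_omegaCenter_eq {R S : Sylow p G} (hR : ∀ A ∈ c.finset, A.1 ≤ R.omegaCenter)
    (hS : ∀ A ∈ c.finset, A.1 ≤ S.omegaCenter) :
    ∃ g : G, (∀ A ∈ c.finset, g • A = A) ∧ MulAut.conj g • R.omegaCenter = S.omegaCenter := by
  obtain ⟨A, hA, hmax⟩ := c.exists_forall_le
  obtain ⟨g, hg, rfl⟩ := Sylow.exists_smul_eq_of_le_omegaCenter (hR A hA) (hS A hA)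
  exact ⟨g, fun B hB => ElemAbelianPoset.smul_eq_self hg (hmax B hB),
    (Sylow.omegaCenter_smul g R).symm⟩

theorem AdjoinOmega.mono (h : RankGapLEOne G p r) (hcd : c ≤ d) (hc : AdjoinOmega p r c e)
    (hd : AdjoinOmega p r d e') : ∃ g : G, g • e ≤ e' := by
  obtain ⟨hc1, R, hcR, he⟩ | ⟨hc1, M, R, hM, hcM, hMR, hcR, he⟩ := hc
  · obtain ⟨hd1, S, hdS, he'⟩ | ⟨hd1, N, S, hN, hdN, hNS, hdS, he'⟩ := hd
    · obtain ⟨g, hg, hgR⟩ := exists_smul_omegaCenter_eq hcR fun A hA => hdS A (hcd hA)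
      refine ⟨g, NonemptyFiniteChains.smul_le_iff.2 fun X hX => (he' _).2 ?_⟩
      obtain hX | hX := (he X).1 hX
      · exact Or.inl (by rw [ElemAbelianPoset.coe_smul, hX, hgR])
      · rw [hg X hX]
        exact Or.inr (hcd hX)
    · obtain ⟨g, hg, hgR⟩ := exists_smul_omegaCenter_eq hcR fun A hA =>
        hdS A (hcd hA) (hc1 A hA)
      refine ⟨g, NonemptyFiniteChains.smul_le_iff.2 fun X hX => (he' _).2 ?_⟩
      obtain hX | hX := (he X).1 hX
      · exact Or.inr (Or.inl (by rw [ElemAbelianPoset.coe_smul, hX, hgR]))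
      · rw [hg X hX]
        exact Or.inr (Or.inr ⟨hcd hX, hc1 X hX⟩)
  · obtain ⟨A, hA, hA', hmax⟩ := exists_max_not_isSubOmega hc1
    obtain ⟨hd1, S, hdS, he'⟩ | ⟨hd1, N, S, hN, hdN, hNS, hdS, he'⟩ := hd
    · exact absurd (hd1 A (hcd hA)) hA'
    · obtain ⟨g, hg, rfl⟩ := h.exists_conj_eq hA' hM hN (hcM A hA) (hdN A (hcd hA))
      -- `B` is the largest kept member of `c`, or trivial if there is none. After `g` has moved `M`
      -- to the big subgroup of `d`, the second conjugator `k` need only normalize the latter and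
      -- centralize `B`, not `A`.
      let B : Subgroup G := ⨆ X : {X // X ∈ c.finset ∧ IsSubOmega p X.1}, X.1.1
      have hXB : ∀ X ∈ c.finset, IsSubOmega p X.1 → X.1 ≤ B := fun X hX hX' =>
        le_iSup (fun X : {X // X ∈ c.finset ∧ IsSubOmega p X.1} => X.1.1) ⟨X, hX, hX'⟩
      have hBA : B ≤ A.1 := iSup_le fun X => hmax X.1 X.2.1
      have hBR : B ≤ R.omegaCenter := iSup_le fun X => hcR X.1 X.2.1 X.2.2
      have hBS : B ≤ S.omegaCenter := iSup_le fun X => hdS X.1 (hcd X.2.1) X.2.2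
      have hBR' : B ≤ (g • R).omegaCenter := by
        rw [Sylow.omegaCenter_smul, ← conj_smul_eq_self_of_le_centralizer hg hBA]
        exact Subgroup.pointwise_smul_le_pointwise_smul_iff.2 hBR
      have hMR' : MulAut.conj g • M ≤ (g • R : Sylow p G) := by
        rw [Sylow.coe_subgroup_smul]
        exact Subgroup.pointwise_smul_le_pointwise_smul_iff.2 hMR
      obtain ⟨k, hk, hkM, hkR⟩ := h.exists_conj_omegaCenter_eq hN
        (fun hs => hA' (hs.mono (hdN A (hcd hA)))) hMR' hNS hBR' hBS
      refine ⟨k * g, NonemptyFiniteChains.smul_le_iff.2 fun X hX => (he' _).2 ?_⟩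
      rw [mul_smul]
      obtain hX | hX | ⟨hX, hX'⟩ := (he X).1 hX
      · exact Or.inl (by rw [ElemAbelianPoset.coe_smul, ElemAbelianPoset.coe_smul, hX, hkM])
      · exact Or.inr (Or.inl (by rw [ElemAbelianPoset.coe_smul, ElemAbelianPoset.coe_smul, hX,
          ← Sylow.omegaCenter_smul, hkR]))
      · rw [ElemAbelianPoset.smul_eq_self hg (hmax X hX),
          ElemAbelianPoset.smul_eq_self hk (hXB X hX hX')]
        exact Or.inr (Or.inr ⟨hcd hX, hX'⟩)

/-- Let `B` be the largest member of `c` in some Ω₁(Z(R)). Since `M` centralizes `B`, a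
C_G(B)-conjugate of `R` contains `M`, and its Ω₁(Z) still contains `B`. -/
theorem exists_sylow_omegaCenter {M : Subgroup G} (hM : IsElemAbelian p M)
    (hcM : ∀ A ∈ c.finset, A.1 ≤ M) : ∃ R : Sylow p G, M ≤ R ∧
      ∀ A ∈ c.finset, IsSubOmega p A.1 → A.1 ≤ R.omegaCenter := by
  classical
  by_cases hne : (c.finset.filter fun A => IsSubOmega p A.1).Nonempty
  · obtain ⟨B, hB⟩ := (c.finset.filter fun A => IsSubOmega p A.1).exists_maximal hne
    obtain ⟨hBc, R, hBR⟩ := Finset.mem_filter.1 hB.1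
    obtain ⟨g, hg, hgM⟩ := Sylow.exists_smul_of_le_omegaCenter hBR hM.isPGroup
      (hM.le_centralizer.trans (Subgroup.centralizer_le (hcM B hBc)))
    refine ⟨g • R, hgM, fun A hA hA' => ?_⟩
    have hAB : A ≤ B := (c.comparable ⟨A, hA⟩ ⟨B, hBc⟩).elim id
      (hB.2 (Finset.mem_filter.2 ⟨hA, hA'⟩))
    rw [Sylow.omegaCenter_smul, ← conj_smul_eq_self_of_le_centralizer hg hAB]
    exact Subgroup.pointwise_smul_le_pointwise_smul_iff.2 (le_trans hAB hBR)
  · obtain ⟨R, hR⟩ := hM.isPGroup.exists_le_sylow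
    exact ⟨R, hR, fun A hA hA' => absurd ⟨A, Finset.mem_filter.2 ⟨hA, hA'⟩⟩ hne⟩

/-- `Ω₁(Z(R))` as a member of `𝒜_p(G)`. -/
def Sylow.omegaPoint (hp : p ∣ Nat.card G) (R : Sylow p G) : ElemAbelianPoset p G :=
  ⟨R.omegaCenter, R.omegaCenter_ne_bot hp, isElemAbelian_omegaOne_centerOf _⟩

theorem exists_chainMaps (h : RankGapLEOne G p r) (hp : p ∣ Nat.card G)
    (c : NonemptyFiniteChains (ElemAbelianPoset p G)) :
    ∃ e₁ e₂ e₃, AdjoinBig p r c e₁ ∧ ReplaceBig p r c e₂ ∧ AdjoinOmega p r c e₃ ∧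
      c ≤ e₁ ∧ e₂ ≤ e₁ ∧ e₂ ≤ e₃ ∧ ∃ R : Sylow p G, R.omegaPoint hp ∈ e₃.finset := by
  obtain ⟨A, hA, hmax⟩ := c.exists_forall_le
  by_cases hA' : IsSubOmega p A.1
  · have hc : ∀ B ∈ c.finset, IsSubOmega p B.1 := fun B hB => hA'.mono (hmax B hB)
    obtain ⟨R, hR⟩ := hA'
    have hcR : ∀ B ∈ c.finset, B.1 ≤ R.omegaCenter := fun B hB => le_trans (hmax B hB) hR
    obtain ⟨e, he⟩ := NonemptyFiniteChains.exists_mem_iff (c.isChain.insert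
      (a := R.omegaPoint hp) fun B hB _ => Or.inr (hcR B hB)) (Set.insert_nonempty _ _)
    refine ⟨c, c, e, Or.inl ⟨hc, rfl⟩, Or.inl ⟨hc, rfl⟩, Or.inl ⟨hc, R, hcR, fun X => ?_⟩,
      le_rfl, le_rfl, fun X hX => (he X).2 (Or.inr hX), R, (he _).2 (Or.inl rfl)⟩
    rw [he, Set.mem_insert_iff, Subtype.ext_iff]
    rfl
  · have hc : ∃ B ∈ c.finset, ¬ IsSubOmega p B.1 := ⟨A, hA, hA'⟩
    obtain ⟨M, hM, hAM⟩ := h.exists_isBig A.2.2 hA'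
    have hcM : ∀ B ∈ c.finset, B.1 ≤ M := fun B hB => le_trans (hmax B hB) hAM
    obtain ⟨R, hMR, hcR⟩ := exists_sylow_omegaCenter hM.1 hcM
    let M' : ElemAbelianPoset p G := ⟨M, fun hb => A.2.1 (le_bot_iff.1 (hb ▸ hAM)), hM.1⟩
    have hc' : IsChain (· ≤ ·) {X | X ∈ c.finset ∧ IsSubOmega p X.1} :=
      c.isChain.mono fun X hX => hX.1
    obtain ⟨e₁, he₁⟩ := NonemptyFiniteChains.exists_mem_iff (c.isChain.insert
      (a := M') fun B hB _ => Or.inr (hcM B hB)) (Set.insert_nonempty _ _)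
    obtain ⟨e₂, he₂⟩ := NonemptyFiniteChains.exists_mem_iff (hc'.insert
      (a := M') fun B hB _ => Or.inr (hcM B hB.1)) (Set.insert_nonempty _ _)
    obtain ⟨e₃, he₃⟩ := NonemptyFiniteChains.exists_mem_iff ((hc'.insert
      (a := R.omegaPoint hp) fun B hB _ => Or.inr (hcR B hB.1 hB.2)).insert (a := M') (by
        rintro B (rfl | hB) -
        · exact Or.inr (h.omegaCenter_le hM hMR)
        · exact Or.inr (hcM B hB.1))) (Set.insert_nonempty _ _)
    refine ⟨e₁, e₂, e₃, Or.inr ⟨hc, M, hM, hcM, fun X => ?_⟩, Or.inr ⟨hc, M, hM, hcM, fun X => ?_⟩,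
      Or.inr ⟨hc, M, R, hM, hcM, hMR, hcR, fun X => ?_⟩, fun X hX => (he₁ X).2 (Or.inr hX),
      fun X hX => (he₁ X).2 (((he₂ X).1 hX).imp_right And.left),
      fun X hX => (he₃ X).2 (((he₂ X).1 hX).imp_right Or.inr), R,
      (he₃ _).2 (Or.inr (Or.inl rfl))⟩
    · rw [he₁, Set.mem_insert_iff, Subtype.ext_iff]
      rfl
    · rw [he₂, Set.mem_insert_iff, Subtype.ext_iff]
      rfl
    · rw [he₃, Set.mem_insert_iff, Set.mem_insert_iff, Subtype.ext_iff, Subtype.ext_iff]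
      rfl

end ChainMaps

theorem mainTheorem2 {G : Type*} [Group G] [Finite G] (p : ℕ) [Fact p.Prime]
    (hp : p ∣ Nat.card G) (P : Sylow p G)
    (hrank : (pRank p G : ℤ) - (pRank p (omegaOne p (centerOf (P : Subgroup G))) : ℤ) ≤ 1) :
    ContractibleSpace (ElemAbelianChainOrbitSpace p G) := by
  have h := rankGapLEOne P hrank
  set r := pRank p (omegaOne p (centerOf (P : Subgroup G)))
  choose e₁ e₂ e₃ h₁ h₂ h₃ le₁ le₂ le₃ R hR using exists_chainMaps h hp
  obtain ⟨f₁, hf₁⟩ := OrbitPoset.exists_orderHom (G := G) (AdjoinBig p r)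
    (fun c => ⟨_, h₁ c⟩) (fun g _ _ => AdjoinBig.smul g) (fun _ _ _ _ => AdjoinBig.mono h)
  obtain ⟨f₂, hf₂⟩ := OrbitPoset.exists_orderHom (G := G) (ReplaceBig p r)
    (fun c => ⟨_, h₂ c⟩) (fun g _ _ => ReplaceBig.smul g) (fun _ _ _ _ => ReplaceBig.mono h)
  obtain ⟨f₃, hf₃⟩ := OrbitPoset.exists_orderHom (G := G) (AdjoinOmega p r)
    (fun c => ⟨_, h₃ c⟩) (fun g _ _ => AdjoinOmega.smul g) (fun _ _ _ _ => AdjoinOmega.mono h)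
  obtain ⟨w, hw⟩ := NonemptyFiniteChains.exists_mem_iff
    (IsChain.singleton (r := (· ≤ ·)) (a := P.omegaPoint hp)) (Set.singleton_nonempty _)
  have hle : ∀ {x y : NonemptyFiniteChains (ElemAbelianPoset p G)}, x ≤ y →
      OrbitPoset.mk G x ≤ OrbitPoset.mk G y := fun hxy => ⟨_, _, rfl, rfl, hxy⟩
  -- The four comparisons form the fence from the identity to the constant map at the orbit of the
  -- one-member chain of Ω₁(Z(P)).
  have i₁ : OrderHom.id ≤ f₁ := by
    rintro ⟨c⟩
    exact (hle (le₁ c)).trans (hf₁ _ _ (h₁ c)).ge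
  have i₂ : f₂ ≤ f₁ := by
    rintro ⟨c⟩
    exact ((hf₂ _ _ (h₂ c)).le.trans (hle (le₂ c))).trans (hf₁ _ _ (h₁ c)).ge
  have i₃ : f₂ ≤ f₃ := by
    rintro ⟨c⟩
    exact ((hf₂ _ _ (h₂ c)).le.trans (hle (le₃ c))).trans (hf₃ _ _ (h₃ c)).ge
  have i₄ : OrderHom.const _ (OrbitPoset.mk G w) ≤ f₃ := by
    rintro ⟨c⟩
    refine le_trans ?_ (hf₃ _ _ (h₃ c)).ge
    obtain ⟨g, hg⟩ := MulAction.exists_smul_eq G P (R c)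
    refine OrbitPoset.mk_le_mk_iff.2 ⟨g, NonemptyFiniteChains.smul_le_iff.2 fun X hX => ?_⟩
    obtain rfl : X = P.omegaPoint hp := (hw X).1 hX
    have : g • P.omegaPoint hp = (R c).omegaPoint hp :=
      Subtype.ext (hg ▸ (Sylow.omegaCenter_smul g P).symm)
    exact this ▸ hR c
  rw [contractible_iff_id_nullhomotopic]
  exact ⟨Topology.WithLowerSet.toLowerSet (OrbitPoset.mk G w),
    (((Topology.WithLowerSet.homotopic_of_le i₁).trans
      (Topology.WithLowerSet.homotopic_of_le i₂).symm).trans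
      (Topology.WithLowerSet.homotopic_of_le i₃)).trans
      (Topology.WithLowerSet.homotopic_of_le i₄).symm⟩
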